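/- For $\sigma\in\mathbb R$ let $\mathbb C_\sigma=\{s\in\mathbb C:\operatorname{Re}s>\sigma\}$. Let $\mathcal D$ be the vector space of Dirichlet series $\sum_{n\ge1}a_nn^{-s}$ with complex coefficients that converge at some point of $\mathbb C$, and let $\mathcal H_+$ be the space of those Dirichlet series $\sum_{n\ge1} a_nn^{-s}$ for which $\sum_{n\ge1}|a_n|^2n^{-2/k}<\infty$ for every $k\in\mathbb N$, $k\ge1$ (that is, for which every translated series $\sum a_nn^{-1/k}n^{-s}$ belongs to the Hardy space $\mathcal H^2$); every series in $\mathcal H_+$ converges on $\mathbb C_{1/2}$. Let $\theta\in\mathbb R$ and let $\phi:\mathbb C_\theta\to\mathbb C_{1/2}$ be an arbitrary function. We say that $\phi$ defines a composition operator $C_\phi:\mathcal H_+\to\mathcal D$ if there is a linear map $C_\phi:\mathcal H_+\to\mathcal D$ such that for every $D\in\mathcal H_+$ there is $\sigma\ge\theta$ such that $C_\phi(D)$ converges on $\mathbb C_\sigma$ and $C_\phi(D)(s)=D(\phi(s))$ for all $s\in\mathbb C_\sigma$. Theorem. The function $\phi$ defines a composition operator $C_\phi:\mathcal H_+\to\mathcal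 D$ if and only if there is $\mu\ge\theta$ such that $\phi$ is analytic on $\mathbb C_\mu$ and there are $c_0\in\mathbb N\cup\{0\}$ and a Dirichlet series $\varphi\in\mathcal D$ that converges on $\mathbb C_\mu$ with $$\phi(s)=c_0s+\varphi(s)\qquad\text{for all }s\in\mathbb C_\mu .$$ -/

import Mathlib

open Filter Topology

noncomputable section

namespace DirichletSeries

/-- The open half-plane `ℂ_σ = {s : Re s > σ}`. -/
def halfPlane (σ : ℝ) : Set ℂ := {s | σ < s.re}

/-- The Dirichlet series `∑_{n ≥ 1} a n * n ^ (-s)` converges (possibly only conditionally, i.e. in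
the sense of its ordered partial sums) at the point `s`, with sum `v`. -/
def HasSumAt (a : ℕ → ℂ) (s v : ℂ) : Prop :=
  Tendsto (fun N : ℕ => ∑ n ∈ Finset.Icc 1 N, a n * (n : ℂ) ^ (-s)) atTop (𝓝 v)

theorem HasSumAt.add {a b : ℕ → ℂ} {s v w : ℂ} (ha : HasSumAt a s v) (hb : HasSumAt b s w) :
    HasSumAt (a + b) s (v + w) := by
  have := Tendsto.add ha hb
  simpa only [HasSumAt, Pi.add_apply, add_mul, Finset.sum_add_distrib] using this

theorem HasSumAt.smul {a : ℕ → ℂ} {s v : ℂ} (c : ℂ) (ha : HasSumAt a s v) :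
    HasSumAt (c • a) s (c * v) := by
  have := Tendsto.const_mul c ha
  simpa only [HasSumAt, Pi.smul_apply, smul_eq_mul, mul_assoc, Finset.mul_sum] using this

theorem sum_Icc_eq (a : ℕ → ℂ) (s : ℂ) (N : ℕ) :
    ∑ n ∈ Finset.Icc 1 N, a n * (n : ℂ) ^ (-s) = ∑ n ∈ Finset.range (N + 1), LSeries.term a s n := by
  rw [Finset.sum_range_succ', LSeries.term_zero, add_zero, Finset.range_eq_Ico,
    Finset.sum_Ico_add' (fun n => LSeries.term a s n) 0 N 1]
  refine Finset.sum_congr (by ext; simp) fun n hn => ?_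
  have : n ≠ 0 := by
    have := (Finset.mem_Ico.mp hn).1
    omega
  rw [LSeries.term_of_ne_zero this, Complex.cpow_neg, div_eq_mul_inv]

theorem hasSumAt_of_summable {a : ℕ → ℂ} {s : ℂ} (h : LSeriesSummable a s) :
    HasSumAt a s (LSeries a s) := by
  have := (h.hasSum.tendsto_sum_nat).comp (tendsto_add_atTop_nat 1)
  simpa only [HasSumAt, sum_Icc_eq, Function.comp_def, LSeries] using this

theorem HasSumAt.summable {a : ℕ → ℂ} {s v : ℂ} (h : HasSumAt a s v) {w : ℂ}
    (hw : s.re + 1 < w.re) : LSeriesSummable a w := by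
  have h1 : Tendsto (fun N => ∑ n ∈ Finset.range (N + 1), LSeries.term a s n) atTop (𝓝 v) := by
    simpa only [HasSumAt, sum_Icc_eq] using h
  have h2 := (tendsto_add_atTop_iff_nat
    (f := fun N => ∑ n ∈ Finset.range N, LSeries.term a s n) 1).mp h1
  have h3 : Tendsto (fun N => LSeries.term a s N) atTop (𝓝 0) := by
    have := h1.sub h2
    simpa [Finset.sum_range_succ] using this
  obtain ⟨C, hC⟩ := (h3.norm.bddAbove_range)
  refine LSeriesSummable_of_le_const_mul_rpow (x := s.re + 1) hw ⟨C, fun n hn => ?_⟩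
  have h4 : ‖LSeries.term a s n‖ ≤ C := hC ⟨n, rfl⟩
  have hp : (0 : ℝ) < (n : ℝ) ^ s.re := Real.rpow_pos_of_pos (by positivity) _
  rw [LSeries.term_of_ne_zero hn, norm_div,
    Complex.norm_natCast_cpow_of_pos (Nat.pos_of_ne_zero hn), div_le_iff₀ hp] at h4
  simpa using h4

/-- The space `𝒟` of Dirichlet series that converge at some point. A Dirichlet series is given by
its coefficients `a n`, `n ≥ 1`; the unused entry `a 0` is normalised to be zero. -/
def D : Submodule ℂ (ℕ → ℂ) where
  carrier := {a | a 0 = 0 ∧ ∃ s v : ℂ, HasSumAt a s v}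
  zero_mem' := ⟨rfl, 0, 0, by simp [HasSumAt]⟩
  add_mem' := by
    rintro a b ⟨ha0, s, v, ha⟩ ⟨hb0, t, w, hb⟩
    refine ⟨by simp [ha0, hb0], ((max s.re t.re + 2 : ℝ) : ℂ), _,
      (hasSumAt_of_summable (ha.summable ?_)).add (hasSumAt_of_summable (hb.summable ?_))⟩
    · rw [Complex.ofReal_re]; linarith [le_max_left s.re t.re]
    · rw [Complex.ofReal_re]; linarith [le_max_right s.re t.re]
  smul_mem' := by
    rintro c a ⟨ha0, s, v, ha⟩
    exact ⟨by simp [ha0], s, _, ha.smul c⟩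

/-- The Hardy space `ℋ²` of Dirichlet series with square-summable coefficients. -/
def H2 : Submodule ℂ (ℕ → ℂ) where
  carrier := {a | a 0 = 0 ∧ Memℓp a 2}
  zero_mem' := ⟨rfl, zero_memℓp⟩
  add_mem' := fun ha hb => ⟨by simp [ha.1, hb.1], ha.2.add hb.2⟩
  smul_mem' := fun c _ ha => ⟨by simp [ha.1], ha.2.const_smul c⟩

/-- The coefficients of the translated series `∑ (a n / n ^ σ) n ^ (-s)`. -/
def translate (σ : ℝ) : (ℕ → ℂ) →ₗ[ℂ] (ℕ → ℂ) where
  toFun a n := a n * (n : ℂ) ^ (-(σ : ℂ))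
  map_add' a b := by ext n; simp [add_mul]
  map_smul' c a := by ext n; simp [mul_assoc]

/-- The space `ℋ₊` of Dirichlet series all of whose translates by `1 / k`, `k = 1, 2, …`, belong to
`ℋ²`. -/
def HPlus : Submodule ℂ (ℕ → ℂ) where
  carrier := {a | a 0 = 0 ∧ ∀ k : ℕ, 1 ≤ k → translate (1 / (k : ℝ)) a ∈ H2}
  zero_mem' := ⟨rfl, fun k _ => by rw [map_zero]; exact H2.zero_mem⟩
  add_mem' := fun ha hb =>
    ⟨by simp [ha.1, hb.1], fun k hk => by rw [map_add]; exact H2.add_mem (ha.2 k hk) (hb.2 k hk)⟩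
  smul_mem' := fun c _ ha =>
    ⟨by simp [ha.1], fun k hk => by rw [map_smul]; exact H2.smul_mem c (ha.2 k hk)⟩

/-- `φ : ℂ_θ → ℂ_{1/2}` defines a composition operator `C_φ : ℋ₊ → 𝒟`: there is a linear map `C`
such that, for every `a ∈ ℋ₊`, the series `C a ∈ 𝒟` represents `s ↦ ∑ a n * n ^ (-φ s)` on some
half-plane contained in `ℂ_θ` (which may depend on `a`). -/
def DefinesCompositionOperator (θ : ℝ) (φ : ℂ → ℂ) : Prop :=
  ∃ C : HPlus →ₗ[ℂ] D, ∀ a : HPlus, ∃ σ : ℝ, θ ≤ σ ∧ ∀ s ∈ halfPlane σ,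
    ∃ v : ℂ, HasSumAt (a : ℕ → ℂ) (φ s) v ∧ HasSumAt (C a : ℕ → ℂ) s v

end DirichletSeries

end

/-!
Forward direction. Applied to `n ^ (-s)`, the operator shows that `n ^ (-φ s)` is a Dirichlet
series; let `m n` be the index of its first nonzero coefficient. Along the real axis `Re φ x / x`
tends to some `κ`, and `m n = n ^ κ` is an integer for every `n`, so finite differences force `κ` to
be a natural number `c`. Taking the logarithm of `n ^ (c s) n ^ (-φ s)` expands `φ s - c s`, up to a
multiple of `2 π i / log n`, into a general Dirichlet series with frequencies `log (k / n ^ (c j))`.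
The expansions for `n = 2` and `n = 3` differ by a constant, because their difference is a
continuous function with countably many values on a half-plane. Both are therefore expansions of
`φ s - c s` itself. Bohr coefficients are mean values, so only the frequencies common to both
survive, and these are logarithms of natural numbers.

Backward direction. If `φ s = c s + ∑ e k k ^ (-s)` takes values in `Re > 1/2`, then, for `c = 0`,
rotating the first nonconstant term to be negative shows `Re e 1 > 1/2`. For every `c` this leaves
room, far to the right, to expand each term of `∑ a n n ^ (-φ s)` into a Dirichlet series and
rearrange: the double series still converges when all coefficients are replaced by their moduli.
-/

open scoped NNReal

namespace DirichletSeries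

theorem exists_intCast_eq_of_hasDerivAt (k : ℕ) {F : ℕ → ℝ → ℝ}
    (hF : ∀ i x, 0 < x → HasDerivAt (F i) (F (i + 1) x) x)
    (h0 : ∀ n : ℕ, 0 < n → ∃ z : ℤ, F 0 n = z) {n : ℕ} (hn : 0 < n) :
    ∃ ξ : ℝ, n ≤ ξ ∧ ∃ z : ℤ, F k ξ = z := by
  induction k generalizing F with
  | zero => exact ⟨n, le_rfl, h0 n hn⟩
  | succ k ih =>
    -- The unit differences `F i (x + 1) - F i x` satisfy the same hypotheses, and the mean value
    -- theorem turns an integer value of a unit difference of `F k` into one of `F (k + 1)`.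
    obtain ⟨ξ, hnξ, z, hz⟩ := ih (F := fun i x => F i (x + 1) - F i x)
      (fun i x hx => ((hF i (x + 1) (by linarith)).comp_add_const x 1).sub (hF i x hx))
      (fun n hn => by
        obtain ⟨z, hz⟩ := h0 n hn
        obtain ⟨w, hw⟩ := h0 (n + 1) n.succ_pos
        exact ⟨w - z, by push_cast at hw ⊢; rw [hw, hz]⟩)
    have hξ : 0 < ξ := (Nat.cast_pos.mpr hn).trans_le hnξ
    obtain ⟨η, hη, hslope⟩ := exists_hasDerivAt_eq_slope (F k) (F (k + 1)) (lt_add_one ξ)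
      (fun x hx => (hF k x (hξ.trans_le hx.1)).continuousAt.continuousWithinAt)
      (fun x hx => hF k x (hξ.trans hx.1))
    exact ⟨η, hnξ.trans hη.1.le, z, by rw [hslope, hz, add_sub_cancel_left, div_one]⟩

theorem hasDerivAt_descPochhammer_mul_rpow (κ : ℝ) (i : ℕ) {x : ℝ} (hx : 0 < x) :
    HasDerivAt (fun y => (descPochhammer ℝ i).eval κ * y ^ (κ - i))
      ((descPochhammer ℝ (i + 1)).eval κ * x ^ (κ - (i + 1 : ℕ))) x := by
  refine ((Real.hasDerivAt_rpow_const (Or.inl hx.ne')).const_mul _).congr_deriv ?_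
  rw [descPochhammer_succ_eval, Nat.cast_succ, sub_sub, mul_assoc]

theorem exists_natCast_eq_of_forall_rpow {κ : ℝ}
    (h : ∀ n : ℕ, 0 < n → ∃ z : ℤ, (n : ℝ) ^ κ = z) : ∃ c : ℕ, κ = c := by
  set k := ⌊κ⌋₊ + 1
  have hκ : 0 < k - κ := sub_pos.mpr (by simpa [k] using Nat.lt_floor_add_one κ)
  set P := (descPochhammer ℝ k).eval κ with hP
  have hlim : Tendsto (fun x : ℝ => P * x ^ (κ - k)) atTop (𝓝 0) := by
    simpa using (tendsto_rpow_neg_atTop hκ).const_mul P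
  obtain ⟨X, hX⟩ := eventually_atTop.mp ((Metric.tendsto_nhds.mp hlim) 1 one_pos)
  obtain ⟨n, hn⟩ := exists_nat_gt (max X 0)
  have hn0 : (0 : ℝ) < n := (le_max_right _ _).trans_lt hn
  obtain ⟨ξ, hnξ, z, hz⟩ := exists_intCast_eq_of_hasDerivAt k
    (fun i x hx => hasDerivAt_descPochhammer_mul_rpow κ i hx) (by simpa using h)
    (Nat.cast_pos.mp hn0)
  have hz0 : z = 0 := by
    have hlt := hX ξ (((le_max_left _ _).trans hn.le).trans hnξ)
    rw [hz, dist_zero_right, Int.norm_cast_real, Int.norm_eq_abs] at hlt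
    exact Int.abs_lt_one_iff.mp (by exact_mod_cast hlt)
  have hP0 : P = 0 := by
    rw [hz0, Int.cast_zero] at hz
    exact (mul_eq_zero.mp hz).resolve_right (Real.rpow_pos_of_pos (hn0.trans_le hnξ) _).ne'
  rw [hP, descPochhammer_eval_eq_prod_range, Finset.prod_eq_zero_iff] at hP0
  obtain ⟨c, -, hc⟩ := hP0
  exact ⟨c, sub_eq_zero.mp hc⟩

theorem exists_eqOn_add_zsmul_of_isPreconnected {X E : Type*} [TopologicalSpace X]
    [NormedAddCommGroup E] {s : Set X} (hs : IsPreconnected s) {f g h : X → E}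
    (hg : ContinuousOn g s) (hh : ContinuousOn h s) {a b : E}
    (hab : ∀ k l : ℤ, k • a = l • b → k = 0 ∧ l = 0)
    (hfg : ∀ x ∈ s, ∃ k : ℤ, f x = g x + k • a) (hfh : ∀ x ∈ s, ∃ l : ℤ, f x = h x + l • b) :
    ∃ k l : ℤ, ∀ x ∈ s, f x = g x + k • a ∧ f x = h x + l • b := by
  obtain rfl | ⟨x₀, hx₀⟩ := s.eq_empty_or_nonempty
  · exact ⟨0, 0, by simp⟩
  choose! k hk using hfg
  choose! l hl using hfh
  have hdiff : ∀ x ∈ s, h x - g x = k x • a - l x • b := fun x hx => by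
    rw [sub_eq_sub_iff_add_eq_add, ← hl x hx, hk x hx, add_comm]
  have hsub : ((fun x => h x - g x) '' s).Subsingleton :=
    (Set.countable_range fun p : ℤ × ℤ => p.1 • a - p.2 • b).isTotallyDisconnected _
      (Set.image_subset_iff.mpr fun x hx => ⟨(k x, l x), (hdiff x hx).symm⟩)
      (hs.image _ (hh.sub hg))
  refine ⟨k x₀, l x₀, fun x hx => ?_⟩
  have hconst : k x • a - l x • b = k x₀ • a - l x₀ • b := by
    rw [← hdiff x hx, ← hdiff x₀ hx₀]
    exact hsub ⟨x, hx, rfl⟩ ⟨x₀, hx₀, rfl⟩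
  obtain ⟨hkx, hlx⟩ := hab (k x - k x₀) (l x - l x₀) (by
    rw [sub_smul, sub_smul]; exact sub_eq_sub_iff_sub_eq_sub.mp hconst)
  rw [← sub_eq_zero.mp hkx, ← sub_eq_zero.mp hlx]
  exact ⟨hk x hx, hl x hx⟩

theorem eq_zero_of_mul_log_eq_mul_log {p q : ℕ} (hp : 1 < p) (hq : 1 < q) (hpq : p.Coprime q)
    {k l : ℤ} (h : k * Real.log p = l * Real.log q) : k = 0 ∧ l = 0 := by
  have hlogp : 0 < Real.log p := Real.log_pos (by exact_mod_cast hp)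
  have hlogq : 0 < Real.log q := Real.log_pos (by exact_mod_cast hq)
  have hpow : p ^ k.natAbs = q ^ l.natAbs := by
    have habs := congrArg abs h
    rw [abs_mul, abs_mul, abs_of_pos hlogp, abs_of_pos hlogq, ← Int.cast_abs, ← Int.cast_abs,
      ← Int.natCast_natAbs, ← Int.natCast_natAbs, Int.cast_natCast, Int.cast_natCast,
      ← Real.log_pow, ← Real.log_pow] at habs
    exact_mod_cast Real.log_injOn_pos (Set.mem_Ioi.mpr (by positivity))
      (Set.mem_Ioi.mpr (by positivity)) habs
  have hcop := hpq.pow k.natAbs l.natAbs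
  have hpone : p ^ k.natAbs = 1 := hcop.eq_one_of_dvd hpow.dvd
  have hqone : q ^ l.natAbs = 1 := hpow.symm.trans hpone
  exact ⟨Int.natAbs_eq_zero.mp ((pow_eq_one_iff_right hp.ne').mp hpone),
    Int.natAbs_eq_zero.mp ((pow_eq_one_iff_right hq.ne').mp hqone)⟩

theorem eq_zero_of_zsmul_period_eq_zsmul_period {p q : ℕ} (hp : 1 < p) (hq : 1 < q)
    (hpq : p.Coprime q) {k l : ℤ}
    (h : k • (2 * Real.pi * Complex.I / Real.log p) = l • (2 * Real.pi * Complex.I / Real.log q)) :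
    k = 0 ∧ l = 0 := by
  have hlogp : Real.log p ≠ 0 := (Real.log_pos (by exact_mod_cast hp)).ne'
  have hlogq : Real.log q ≠ 0 := (Real.log_pos (by exact_mod_cast hq)).ne'
  have hcross : (l : ℂ) * Real.log p = k * Real.log q := by
    rw [zsmul_eq_mul, zsmul_eq_mul, mul_div_left_comm, mul_div_left_comm (l : ℂ)] at h
    have := mul_left_cancel₀ Complex.two_pi_I_ne_zero h
    rw [div_eq_div_iff (by exact_mod_cast hlogp) (by exact_mod_cast hlogq)] at this
    exact this.symm
  exact (eq_zero_of_mul_log_eq_mul_log hp hq hpq (by exact_mod_cast hcross)).symm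

theorem norm_mul_exp_eq (c : ℂ) (x : ℝ) (s : ℂ) :
    ‖c * Complex.exp (-(x * s))‖ = ‖c‖ * Real.exp (-(x * s.re)) := by
  simp [Complex.norm_exp]

theorem norm_mul_exp_le (c : ℂ) (x : ℝ≥0) {σ : ℝ} {s : ℂ} (hs : σ ≤ s.re) :
    ‖c * Complex.exp (-((x : ℝ) * s))‖ ≤ ‖c‖ * Real.exp (-(x * σ)) := by
  rw [norm_mul_exp_eq]
  gcongr

/-- On the closed half-plane `σ ≤ Re s`, the function `f` is the sum of a general Dirichlet series
`∑ c i * exp (-(l i) * s)` with frequencies `l i` in `S`, and the sum of the moduli of its terms on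
the line `Re s = σ` is `M`. Frequencies may be repeated, which makes sums and products of such
series immediate. -/
def HasExpansion (S : Set ℝ≥0) (σ : ℝ) (f : ℂ → ℂ) (M : ℝ) : Prop :=
  ∃ (ι : Type) (_ : Countable ι) (l : ι → ℝ≥0) (c : ι → ℂ), (∀ i, l i ∈ S) ∧
    HasSum (fun i => ‖c i‖ * Real.exp (-(l i * σ))) M ∧
    ∀ s : ℂ, σ ≤ s.re → HasSum (fun i => c i * Complex.exp (-((l i : ℝ) * s))) (f s)

namespace HasExpansion

section Set

variable {S T : Set ℝ≥0} {σ : ℝ} {f g : ℂ → ℂ} {M N : ℝ}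

theorem congr (h : HasExpansion S σ f M) (hfg : ∀ s : ℂ, σ ≤ s.re → f s = g s) :
    HasExpansion S σ g M := by
  obtain ⟨ι, hι, l, c, hl, hM, hf⟩ := h
  exact ⟨ι, hι, l, c, hl, hM, fun s hs => hfg s hs ▸ hf s hs⟩

theorem mono_freq (h : HasExpansion S σ f M) (hST : S ⊆ T) : HasExpansion T σ f M := by
  obtain ⟨ι, hι, l, c, hl, hM, hf⟩ := h
  exact ⟨ι, hι, l, c, fun i => hST (hl i), hM, hf⟩

theorem nonneg (h : HasExpansion S σ f M) : 0 ≤ M := by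
  obtain ⟨ι, -, l, c, -, hM, -⟩ := h
  exact hM.nonneg fun i => by positivity

theorem norm_le (h : HasExpansion S σ f M) {s : ℂ} (hs : σ ≤ s.re) : ‖f s‖ ≤ M := by
  obtain ⟨ι, -, l, c, -, hM, hf⟩ := h
  exact (hf s hs).tsum_eq ▸ tsum_of_norm_bounded hM fun i => norm_mul_exp_le _ _ hs

theorem continuousOn (h : HasExpansion S σ f M) : ContinuousOn f {s | σ ≤ s.re} := by
  obtain ⟨ι, -, l, c, -, hM, hf⟩ := h
  exact (continuousOn_tsum (f := fun i s => c i * Complex.exp (-((l i : ℝ) * s)))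
    (fun i => by fun_prop) hM.summable fun i s hs => norm_mul_exp_le _ _ hs).congr
    fun s hs => (hf s hs).tsum_eq.symm

theorem eventually_exists_lt (h : HasExpansion S σ f M) (h0 : 0 ∉ S) {ε : ℝ} (hε : 0 < ε) :
    ∀ᶠ τ in atTop, ∃ N < ε, HasExpansion S τ f N := by
  obtain ⟨ι, hι, l, c, hl, hM, hf⟩ := h
  have hle : ∀ τ, σ ≤ τ → ∀ i,
      ‖c i‖ * Real.exp (-(l i * τ)) ≤ ‖c i‖ * Real.exp (-(l i * σ)) := fun τ hτ i => by gcongr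
  have hlim : Tendsto (fun τ => ∑' i, ‖c i‖ * Real.exp (-(l i * τ))) atTop (𝓝 (∑' _ : ι, 0)) := by
    refine tendsto_tsum_of_dominated_convergence hM.summable (fun i => ?_) ?_
    · have hli : (0 : ℝ) < l i := NNReal.coe_pos.mpr (pos_of_ne_zero fun h => h0 (h ▸ hl i))
      simpa using (Real.tendsto_exp_neg_atTop_nhds_zero.comp
        (tendsto_id.const_mul_atTop hli)).const_mul ‖c i‖
    · filter_upwards [eventually_ge_atTop σ] with τ hτ i
      rw [Real.norm_of_nonneg (by positivity)]
      exact hle τ hτ i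
  rw [tsum_zero] at hlim
  filter_upwards [hlim.eventually_lt_const hε, eventually_ge_atTop σ] with τ hlt hτ
  exact ⟨_, hlt, ι, hι, l, c, hl,
    (hM.summable.of_nonneg_of_le (fun i => by positivity) (hle τ hτ)).hasSum,
    fun s hs => hf s (hτ.trans hs)⟩

theorem term {x : ℝ≥0} (hx : x ∈ S) (c : ℂ) :
    HasExpansion S σ (fun s => c * Complex.exp (-((x : ℝ) * s))) (‖c‖ * Real.exp (-(x * σ))) :=
  ⟨Unit, inferInstance, fun _ => x, fun _ => c, fun _ => hx, by simp, fun s _ => by simp⟩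

theorem const (h0 : 0 ∈ S) (c : ℂ) : HasExpansion S σ (fun _ => c) ‖c‖ := by
  simpa using term (σ := σ) h0 c

theorem hasSum {J : Type} [Countable J] {F : J → ℂ → ℂ} {K : J → ℝ}
    (hF : ∀ j, HasExpansion S σ (F j) (K j)) (hK : HasSum K M)
    (hf : ∀ s : ℂ, σ ≤ s.re → HasSum (fun j => F j s) (f s)) : HasExpansion S σ f M := by
  choose ι hι l c hl hM hF using hF
  have hsummable : Summable fun p : Σ j, ι j => ‖c p.1 p.2‖ * Real.exp (-(l p.1 p.2 * σ)) :=
    (summable_sigma_of_nonneg fun p => by positivity).mpr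
      ⟨fun j => (hM j).summable, hK.summable.congr fun j => (hM j).tsum_eq.symm⟩
  refine ⟨Σ j, ι j, inferInstance, fun p => l p.1 p.2, fun p => c p.1 p.2, fun p => hl _ _,
    HasSum.sigma_of_hasSum hK hM hsummable, fun s hs => ?_⟩
  exact HasSum.sigma_of_hasSum (hf s hs) (fun j => hF j s hs)
    (hsummable.of_norm_bounded fun p => norm_mul_exp_le _ _ hs)

theorem add (hf : HasExpansion S σ f M) (hg : HasExpansion S σ g N) :
    HasExpansion S σ (fun s => f s + g s) (M + N) := by
  refine hasSum (F := fun b => bif b then f else g) (K := fun b => bif b then M else N)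
    (Bool.forall_bool.mpr ⟨hg, hf⟩) ?_ fun s _ => ?_
  · simpa using hasSum_fintype fun b => bif b then M else N
  · simpa using hasSum_fintype fun b => (bif b then f else g) s

end Set

section AddSubmonoid

variable {S : AddSubmonoid ℝ≥0} {σ : ℝ} {f g : ℂ → ℂ} {M N : ℝ}

theorem mul (hf : HasExpansion S σ f M) (hg : HasExpansion S σ g N) :
    HasExpansion S σ (fun s => f s * g s) (M * N) := by
  obtain ⟨ι, hι, l, c, hl, hM, hf⟩ := hf
  obtain ⟨κ, hκ, l', c', hl', hN, hg⟩ := hg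
  have hnorm : HasSum
      (fun p : ι × κ => ‖c p.1 * c' p.2‖ * Real.exp (-((l p.1 + l' p.2 : ℝ≥0) * σ))) (M * N) := by
    simpa only [norm_mul, NNReal.coe_add, add_mul, neg_add, Real.exp_add, mul_mul_mul_comm] using
      hM.mul hN (hM.summable.mul_of_nonneg hN.summable (fun i => by positivity)
        fun i => by positivity)
  refine ⟨ι × κ, inferInstance, fun p => l p.1 + l' p.2, fun p => c p.1 * c' p.2,
    fun p => S.add_mem (hl _) (hl' _), hnorm, fun s hs => ?_⟩
  have hterm : ∀ p : ι × κ, c p.1 * Complex.exp (-((l p.1 : ℝ) * s)) *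
      (c' p.2 * Complex.exp (-((l' p.2 : ℝ) * s))) =
      c p.1 * c' p.2 * Complex.exp (-(((l p.1 + l' p.2 : ℝ≥0) : ℝ) * s)) := fun p => by
    rw [NNReal.coe_add, Complex.ofReal_add, add_mul, neg_add, Complex.exp_add, mul_mul_mul_comm]
  simpa only [hterm] using (hf s hs).mul (hg s hs) (by
    simpa only [hterm] using hnorm.summable.of_norm_bounded fun p => norm_mul_exp_le _ _ hs)

theorem const_mul (hf : HasExpansion S σ f M) (c : ℂ) :
    HasExpansion S σ (fun s => c * f s) (‖c‖ * M) :=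
  (const S.zero_mem c).mul hf

theorem pow (hf : HasExpansion S σ f M) (k : ℕ) : HasExpansion S σ (fun s => f s ^ k) (M ^ k) := by
  induction k with
  | zero => simpa using const (σ := σ) S.zero_mem (1 : ℂ)
  | succ k ih => simpa only [pow_succ] using ih.mul hf

theorem cexp (hf : HasExpansion S σ f M) :
    HasExpansion S σ (fun s => Complex.exp (f s)) (Real.exp M) := by
  refine hasSum (F := fun k s => (k.factorial : ℂ)⁻¹ * f s ^ k) (fun k => (hf.pow k).const_mul _)
    ?_ fun s _ => ?_
  · simpa [Real.exp_eq_exp_ℝ, div_eq_inv_mul] using NormedSpace.expSeries_div_hasSum_exp M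
  · simpa [Complex.exp_eq_exp_ℂ, div_eq_inv_mul] using NormedSpace.expSeries_div_hasSum_exp (f s)

theorem clog (hf : HasExpansion S σ f M) (hM : M < 1) :
    ∃ N, HasExpansion S σ (fun s => Complex.log (1 + f s)) N := by
  have hsummable : Summable fun k : ℕ => ‖(-1 : ℂ) ^ (k + 1) / k‖ * M ^ k := by
    refine (summable_geometric_of_lt_one hf.nonneg hM).of_nonneg_of_le
      (fun k => mul_nonneg (norm_nonneg _) (pow_nonneg hf.nonneg k)) fun k =>
      mul_le_of_le_one_left (pow_nonneg hf.nonneg k) ?_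
    simpa using Nat.cast_inv_le_one k
  refine ⟨_, hasSum (F := fun (k : ℕ) s => (-1 : ℂ) ^ (k + 1) / k * f s ^ k)
    (fun k => (hf.pow k).const_mul _) hsummable.hasSum fun s hs => ?_⟩
  simpa only [div_mul_eq_mul_div] using
    Complex.hasSum_taylorSeries_log ((hf.norm_le hs).trans_lt hM)

end AddSubmonoid

end HasExpansion

theorem norm_cexp_mul_I_mul (u t : ℝ) : ‖Complex.exp (u * Complex.I * t)‖ = 1 := by
  rw [mul_right_comm, ← Complex.ofReal_mul, Complex.norm_exp_ofReal_mul_I]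

theorem norm_mean_cexp_le_one (u : ℝ) {T : ℝ} (hT : 0 < T) :
    ‖(T : ℂ)⁻¹ * ∫ t in (0 : ℝ)..T, Complex.exp (u * Complex.I * t)‖ ≤ 1 := by
  have hint : ‖∫ t in (0 : ℝ)..T, Complex.exp (u * Complex.I * t)‖ ≤ T := by
    simpa [abs_of_pos hT] using intervalIntegral.norm_integral_le_of_norm_le_const (a := 0) (b := T)
      fun t _ => (norm_cexp_mul_I_mul u t).le
  rwa [norm_mul, norm_inv, Complex.norm_real, Real.norm_of_nonneg hT.le, inv_mul_le_one₀ hT]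

theorem tendsto_mean_cexp (u : ℝ) :
    Tendsto (fun T : ℝ => (T : ℂ)⁻¹ * ∫ t in (0 : ℝ)..T, Complex.exp (u * Complex.I * t)) atTop
      (𝓝 (if u = 0 then 1 else 0)) := by
  split_ifs with hu
  · refine tendsto_const_nhds.congr' ?_
    filter_upwards [eventually_ne_atTop 0] with T hT
    simp [hu, hT]
  · have hlim : Tendsto (fun T : ℝ => T⁻¹ * (2 / |u|)) atTop (𝓝 0) := by
      simpa using tendsto_inv_atTop_zero.mul_const (2 / |u|)
    refine squeeze_zero_norm' ?_ hlim
    filter_upwards [eventually_gt_atTop 0] with T hT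
    have hnum : ‖Complex.exp (u * Complex.I * T) - Complex.exp (u * Complex.I * (0 : ℝ))‖ ≤ 2 := by
      refine (norm_sub_le _ _).trans ?_
      rw [norm_cexp_mul_I_mul, norm_cexp_mul_I_mul, one_add_one_eq_two]
    rw [integral_exp_mul_complex (by simpa using hu), norm_mul, norm_div, norm_inv,
      Complex.norm_real, Real.norm_of_nonneg hT.le, norm_mul, Complex.norm_I, mul_one,
      Complex.norm_real, Real.norm_eq_abs]
    gcongr

theorem tendsto_mean_of_hasSum {ι : Type*} [Countable ι] {u : ι → ℝ} {w : ι → ℂ} {g : ℝ → ℂ}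
    (hw : Summable fun i => ‖w i‖)
    (hg : ∀ t : ℝ, HasSum (fun i => w i * Complex.exp (u i * Complex.I * t)) (g t)) :
    Tendsto (fun T : ℝ => (T : ℂ)⁻¹ * ∫ t in (0 : ℝ)..T, g t) atTop
      (𝓝 (∑' i, if u i = 0 then w i else 0)) := by
  have hint : ∀ T : ℝ, HasSum
      (fun i => w i * ((T : ℂ)⁻¹ * ∫ t in (0 : ℝ)..T, Complex.exp (u i * Complex.I * t)))
      ((T : ℂ)⁻¹ * ∫ t in (0 : ℝ)..T, g t) := fun T => by
    have h := intervalIntegral.hasSum_integral_of_dominated_convergence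
      (μ := MeasureTheory.volume) (a := 0) (b := T)
      (F := fun i (t : ℝ) => w i * Complex.exp (u i * Complex.I * t)) (fun i _ => ‖w i‖)
      (fun i => (by fun_prop : Continuous _).aestronglyMeasurable)
      (fun i => .of_forall fun t _ => by rw [norm_mul, norm_cexp_mul_I_mul, mul_one])
      (.of_forall fun t _ => hw) (by simp) (.of_forall fun t _ => hg t)
    simpa only [intervalIntegral.integral_const_mul, mul_left_comm] using h.mul_left (T : ℂ)⁻¹
  refine Tendsto.congr (fun T => (hint T).tsum_eq) ?_
  refine tendsto_tsum_of_dominated_convergence hw (fun i => ?_) ?_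
  · simpa using (tendsto_mean_cexp (u i)).const_mul (w i)
  · filter_upwards [eventually_gt_atTop 0] with T hT i
    rw [norm_mul]
    exact mul_le_of_le_one_right (norm_nonneg _) (norm_mean_cexp_le_one _ hT)

/-- The Bohr coefficient of `f` at the frequency `x`, read off as the mean value of
`f s * exp (x * s)` along the line `Re s = σ`. -/
noncomputable def bohrCoeff (σ : ℝ) (f : ℂ → ℂ) (x : ℝ≥0) : ℂ :=
  limUnder atTop fun T : ℝ => (T : ℂ)⁻¹ *
    ∫ t in (0 : ℝ)..T, f (σ + t * Complex.I) * Complex.exp ((x : ℝ) * (σ + t * Complex.I))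

theorem bohrCoeff_eq_tsum {ι : Type*} [Countable ι] {l : ι → ℝ≥0} {c : ι → ℂ} {σ : ℝ} {f : ℂ → ℂ}
    (hc : Summable fun i => ‖c i‖ * Real.exp (-(l i * σ)))
    (hf : ∀ s : ℂ, σ ≤ s.re → HasSum (fun i => c i * Complex.exp (-((l i : ℝ) * s))) (f s))
    (x : ℝ≥0) : bohrCoeff σ f x = ∑' i : l ⁻¹' {x}, c i := by
  set w : ι → ℂ := fun i => c i * Complex.exp (-((l i : ℝ) * σ)) * Complex.exp ((x : ℝ) * σ)
    with hw
  have hwsum : Summable fun i => ‖w i‖ := by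
    simpa only [hw, norm_mul _ (Complex.exp ((x : ℝ) * σ)), norm_mul_exp_eq, Complex.ofReal_re]
      using hc.mul_right ‖Complex.exp ((x : ℝ) * σ)‖
  have hterm : ∀ (t : ℝ) (i : ι), w i * Complex.exp (((x - l i : ℝ) : ℂ) * Complex.I * t) =
      c i * Complex.exp (-((l i : ℝ) * (σ + t * Complex.I))) *
        Complex.exp ((x : ℝ) * (σ + t * Complex.I)) := fun t i => by
    simp only [hw, mul_assoc, ← Complex.exp_add]
    push_cast
    ring_nf
  have hg : ∀ t : ℝ, HasSum (fun i => w i * Complex.exp (((x - l i : ℝ) : ℂ) * Complex.I * t))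
      (f (σ + t * Complex.I) * Complex.exp ((x : ℝ) * (σ + t * Complex.I))) := fun t => by
    simpa only [hterm] using (hf (σ + t * Complex.I) (by simp)).mul_right _
  have hcoeff : ∀ i, (if ((x : ℝ) - l i) = 0 then w i else 0) = (l ⁻¹' {x}).indicator c i :=
    fun i => by
      by_cases hi : l i = x
      · rw [Set.indicator_of_mem (by exact hi), if_pos (by rw [hi, sub_self])]
        simp only [hw, hi, mul_assoc, ← Complex.exp_add, neg_add_cancel, Complex.exp_zero, mul_one]
      · rw [Set.indicator_of_notMem (by exact hi),
          if_neg (sub_ne_zero.mpr fun h => hi (NNReal.coe_injective h).symm)]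
  rw [tsum_subtype (l ⁻¹' {x}) c, ← tsum_congr hcoeff]
  exact (tendsto_mean_of_hasSum hwsum hg).limUnder_eq

theorem HasExpansion.bohrCoeff_eq_zero {S : Set ℝ≥0} {σ M : ℝ} {f : ℂ → ℂ}
    (h : HasExpansion S σ f M) {x : ℝ≥0} (hx : x ∉ S) : bohrCoeff σ f x = 0 := by
  obtain ⟨ι, hι, l, c, hl, hM, hf⟩ := h
  have : IsEmpty (l ⁻¹' {x}) := ⟨fun i => hx (i.2 ▸ hl i)⟩
  rw [bohrCoeff_eq_tsum hM.summable hf, tsum_empty]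

theorem HasExpansion.hasSum_bohrCoeff {S : Set ℝ≥0} {σ M : ℝ} {f : ℂ → ℂ}
    (h : HasExpansion S σ f M) {s : ℂ} (hs : σ ≤ s.re) :
    HasSum (fun x : ℝ≥0 => bohrCoeff σ f x * Complex.exp (-((x : ℝ) * s))) (f s) := by
  obtain ⟨ι, hι, l, c, -, hM, hf⟩ := h
  have hterm : ∀ x : ℝ≥0, bohrCoeff σ f x * Complex.exp (-((x : ℝ) * s)) =
      ∑' i : l ⁻¹' {x}, c i * Complex.exp (-((l i : ℝ) * s)) := fun x => by
    rw [bohrCoeff_eq_tsum hM.summable hf, ← tsum_mul_right]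
    exact tsum_congr fun i => by rw [show l i = x from i.2]
  simpa only [hterm] using (hf s hs).tsum_fiberwise l

/-- The nonnegative numbers `log (n / p ^ j)`. They are the frequencies that arise when a Dirichlet
series with leading term `p ^ (-s)` is divided by this term and then composed with a power
series. -/
def freq (p : ℕ) : AddSubmonoid ℝ≥0 where
  carrier := {x | ∃ n j : ℕ, n ≠ 0 ∧ (x : ℝ) = Real.log n - j * Real.log p}
  zero_mem' := ⟨1, 0, one_ne_zero, by simp⟩
  add_mem' := by
    rintro x y ⟨n, j, hn, hx⟩ ⟨n', j', hn', hy⟩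
    refine ⟨n * n', j + j', mul_ne_zero hn hn', ?_⟩
    rw [NNReal.coe_add, hx, hy, Nat.cast_mul, Nat.cast_add,
      Real.log_mul (Nat.cast_ne_zero.mpr hn) (Nat.cast_ne_zero.mpr hn')]
    ring

theorem exists_eq_log_of_mem_freq_of_coprime {p q : ℕ} (hp : p ≠ 0) (hq : q ≠ 0)
    (hpq : p.Coprime q) {x : ℝ≥0} (hxp : x ∈ freq p) (hxq : x ∈ freq q) :
    ∃ n : ℕ, n ≠ 0 ∧ (x : ℝ) = Real.log n := by
  obtain ⟨n, j, hn, hx⟩ := hxp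
  obtain ⟨n', j', hn', hx'⟩ := hxq
  have hcross : n * q ^ j' = n' * p ^ j := by
    have hlog : Real.log (n * (q : ℝ) ^ j') = Real.log (n' * (p : ℝ) ^ j) := by
      rw [Real.log_mul (by positivity) (by positivity),
        Real.log_mul (by positivity) (by positivity), Real.log_pow, Real.log_pow]
      linarith
    exact_mod_cast Real.log_injOn_pos (Set.mem_Ioi.mpr (by positivity))
      (Set.mem_Ioi.mpr (by positivity)) hlog
  obtain ⟨k, rfl⟩ : p ^ j ∣ n :=
    (hpq.pow j j').dvd_of_dvd_mul_right (hcross ▸ Dvd.intro_left n' rfl)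
  have hk : k ≠ 0 := right_ne_zero_of_mul hn
  refine ⟨k, hk, ?_⟩
  rw [hx, Nat.cast_mul, Nat.cast_pow, Real.log_mul (by positivity) (by positivity), Real.log_pow,
    add_sub_cancel_left]

theorem natCast_cpow_eq_exp {n : ℕ} (hn : n ≠ 0) (s : ℂ) :
    (n : ℂ) ^ s = Complex.exp (Real.log n * s) := by
  rw [Complex.cpow_def_of_ne_zero (Nat.cast_ne_zero.mpr hn), Complex.natCast_log]

theorem term_eq_mul_exp {n : ℕ} (hn : n ≠ 0) (a : ℕ → ℂ) (s : ℂ) :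
    LSeries.term a s n = a n * Complex.exp (-(Real.log n * s)) := by
  rw [LSeries.term_of_ne_zero hn, natCast_cpow_eq_exp hn, div_eq_mul_inv, Complex.exp_neg]

/-- On the closed half-plane `σ ≤ Re s`, the function `f` is the sum of the absolutely convergent
Dirichlet series with coefficients `a`. -/
def HasLSeriesOn (a : ℕ → ℂ) (f : ℂ → ℂ) (σ : ℝ) : Prop :=
  ∀ ⦃s : ℂ⦄, σ ≤ s.re → LSeriesHasSum a s (f s)

namespace HasLSeriesOn

variable {a b : ℕ → ℂ} {f g : ℂ → ℂ} {σ τ : ℝ}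

theorem mono (h : HasLSeriesOn a f σ) (hτ : σ ≤ τ) : HasLSeriesOn a f τ :=
  fun _ hs => h (hτ.trans hs)

theorem congr (h : HasLSeriesOn a f σ) (hfg : ∀ s : ℂ, σ ≤ s.re → f s = g s) :
    HasLSeriesOn a g σ :=
  fun s hs => hfg s hs ▸ h hs

theorem add (hf : HasLSeriesOn a f σ) (hg : HasLSeriesOn b g σ) :
    HasLSeriesOn (a + b) (fun s => f s + g s) σ :=
  fun _ hs => (hf hs).add (hg hs)

theorem smul (c : ℂ) (hf : HasLSeriesOn a f σ) : HasLSeriesOn (c • a) (fun s => c * f s) σ :=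
  fun _ hs => (hf hs).smul c

theorem abscissaOfAbsConv_le (h : HasLSeriesOn a f σ) : LSeries.abscissaOfAbsConv a ≤ σ :=
  (h (s := σ) le_rfl).LSeriesSummable.abscissaOfAbsConv_le

theorem unique (ha : HasLSeriesOn a f σ) (hb : HasLSeriesOn b f τ) (h0 : a 0 = b 0) : a = b := by
  funext n
  obtain rfl | hn := eq_or_ne n 0
  · exact h0
  refine LSeries.eq_of_LSeries_eventually_eq
    (ha.abscissaOfAbsConv_le.trans_lt (EReal.coe_lt_top σ))
    (hb.abscissaOfAbsConv_le.trans_lt (EReal.coe_lt_top τ)) ?_ hn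
  filter_upwards [eventually_ge_atTop σ, eventually_ge_atTop τ] with x hσ hτ
  exact (ha (s := x) hσ).LSeries_eq.trans (hb (s := x) hτ).LSeries_eq.symm

theorem analyticOnNhd (h : HasLSeriesOn a f σ) : AnalyticOnNhd ℂ f (halfPlane σ) :=
  ((LSeries_analyticOnNhd a).mono fun _ hs =>
    h.abscissaOfAbsConv_le.trans_lt (EReal.coe_lt_coe_iff.mpr hs)).congr
    (isOpen_lt continuous_const Complex.continuous_re) fun _ hs => (h (le_of_lt hs)).LSeries_eq

theorem hasSumAt (h : HasLSeriesOn a f σ) {s : ℂ} (hs : σ ≤ s.re) : HasSumAt a s (f s) :=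
  (h hs).LSeries_eq ▸ hasSumAt_of_summable (h hs).LSeriesSummable

theorem of_hasSumAt (h : ∀ s ∈ halfPlane σ, HasSumAt a s (f s)) (hτ : σ + 1 < τ) :
    HasLSeriesOn a f τ := fun s hs => by
  obtain ⟨x, hσx, hxs⟩ := exists_between (lt_sub_iff_add_lt.mpr (hτ.trans_le hs))
  have hsummable : LSeriesSummable a s := (h x hσx).summable (lt_sub_iff_add_lt.mp hxs)
  exact tendsto_nhds_unique (hasSumAt_of_summable hsummable) (h s (by
    simp only [halfPlane, Set.mem_ofPred_eq]; linarith)) ▸ hsummable.LSeriesHasSum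

theorem mem_D (h : HasLSeriesOn a f σ) (h0 : a 0 = 0) : a ∈ D :=
  ⟨h0, σ, f σ, h.hasSumAt (s := σ) le_rfl⟩

theorem update_zero (h : HasLSeriesOn a f σ) (m : ℕ) :
    HasLSeriesOn (Function.update a m 0) (fun s => f s - LSeries.term a s m) σ := fun s hs => by
  have hterm : LSeries.term (Function.update a m 0) s = Function.update (LSeries.term a s) m 0 := by
    ext n
    obtain rfl | hn := eq_or_ne n m <;> simp [LSeries.term, *]
  simpa only [LSeriesHasSum, hterm, zero_sub, neg_add_eq_sub] using (h hs).update m 0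

theorem exists_hasExpansion_cpow_mul (h : HasLSeriesOn a f σ) {m : ℕ} (hm : m ≠ 0)
    (ha : ∀ k ≤ m, a k = 0) :
    ∃ M, HasExpansion (freq m \ {0}) σ (fun s => (m : ℂ) ^ s * f s) M := by
  have hlog : ∀ k : Set.Ioi m, 0 < Real.log k - Real.log m := fun k =>
    sub_pos.mpr (Real.log_lt_log (by positivity) (Nat.cast_lt.mpr k.2))
  have hcoe : ∀ k : Set.Ioi m, ((Real.log k - Real.log m).toNNReal : ℝ) = Real.log k - Real.log m :=
    fun k => Real.coe_toNNReal _ (hlog k).le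
  have hterm : ∀ (s : ℂ) (k : Set.Ioi m), (m : ℂ) ^ s * LSeries.term a s k =
      a k * Complex.exp (-(((Real.log k - Real.log m).toNNReal : ℝ) * s)) := fun s k => by
    rw [term_eq_mul_exp k.2.ne_bot, natCast_cpow_eq_exp hm, mul_left_comm, ← Complex.exp_add, hcoe]
    push_cast
    ring_nf
  have hsum : ∀ s : ℂ, σ ≤ s.re → HasSum (fun k : Set.Ioi m => a k *
      Complex.exp (-(((Real.log k - Real.log m).toNNReal : ℝ) * s))) ((m : ℂ) ^ s * f s) :=
    fun s hs => by
      simp only [← hterm]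
      refine ((hasSum_subtype_iff_of_support_subset fun k hk => ?_).mpr (h hs)).mul_left _
      by_contra hkm
      exact hk (by simp [LSeries.term, ha k (not_lt.mp hkm)])
  refine ⟨_, Set.Ioi m, inferInstance, fun k => (Real.log k - Real.log m).toNNReal,
    fun k => a k, fun k => ⟨⟨k, 1, k.2.ne_bot, ?_⟩, (Real.toNNReal_pos.mpr (hlog k)).ne'⟩,
    Summable.hasSum ?_, hsum⟩
  · rw [hcoe, Nat.cast_one, one_mul]
  · simpa only [norm_mul_exp_eq, Complex.ofReal_re] using (hsum σ le_rfl).summable.norm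

theorem exists_hasExpansion_sub (h : HasLSeriesOn a f σ) {m : ℕ} (hm : m ≠ 0)
    (ha : ∀ k < m, a k = 0) :
    ∃ M, HasExpansion (freq m \ {0}) σ (fun s => (m : ℂ) ^ s * f s - a m) M := by
  obtain ⟨M, hM⟩ := (h.update_zero m).exists_hasExpansion_cpow_mul hm fun k hk => by
    obtain rfl | hk := hk.eq_or_lt
    · exact Function.update_self ..
    · rw [Function.update_of_ne hk.ne, ha k hk]
  refine ⟨M, hM.congr fun s _ => ?_⟩
  rw [mul_sub, LSeries.term_of_ne_zero hm, mul_div_cancel₀ _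
    (by simp [Complex.cpow_eq_zero_iff, hm])]

end HasLSeriesOn

theorem toNNReal_log_injective :
    Function.Injective fun n : {n : ℕ // n ≠ 0} => (Real.log n).toNNReal := fun n k h => by
  have hlog := (Real.toNNReal_eq_toNNReal_iff (Real.log_natCast_nonneg n)
    (Real.log_natCast_nonneg k)).mp h
  have hpos : ∀ n : {n : ℕ // n ≠ 0}, (0 : ℝ) < (n : ℕ) := fun n =>
    Nat.cast_pos.mpr (Nat.pos_of_ne_zero n.2)
  exact Subtype.ext (Nat.cast_injective (Real.log_injOn_pos (hpos n) (hpos k) hlog))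

theorem HasExpansion.exists_hasLSeriesOn {p q : ℕ} (hp : p ≠ 0) (hq : q ≠ 0) (hpq : p.Coprime q)
    {σ M N : ℝ} {f : ℂ → ℂ} (hfp : HasExpansion (freq p) σ f M)
    (hfq : HasExpansion (freq q) σ f N) : ∃ e : ℕ → ℂ, e 0 = 0 ∧ HasLSeriesOn e f σ := by
  set e : ℕ → ℂ := fun n => if n = 0 then 0 else bohrCoeff σ f (Real.log n).toNNReal with he
  refine ⟨e, if_pos rfl, fun s hs => ?_⟩
  have hterm : ∀ n : {n : ℕ // n ≠ 0}, LSeries.term e s n =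
      bohrCoeff σ f (Real.log n).toNNReal *
        Complex.exp (-(((Real.log n).toNNReal : ℝ) * s)) := fun n => by
    rw [term_eq_mul_exp n.2, he, Real.coe_toNNReal _ (Real.log_natCast_nonneg n)]
    exact congrArg (· * _) (if_neg n.2)
  have hsum : HasSum (fun n : {n : ℕ // n ≠ 0} => LSeries.term e s n) (f s) := by
    simp only [hterm]
    refine (toNNReal_log_injective.hasSum_iff fun x hx => ?_).mpr (hfp.hasSum_bohrCoeff hs)
    rw [mul_eq_zero_iff_right (Complex.exp_ne_zero _)]
    by_contra hne
    obtain ⟨n, hn, hxn⟩ := exists_eq_log_of_mem_freq_of_coprime hp hq hpq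
      (not_imp_comm.mp hfp.bohrCoeff_eq_zero hne) (not_imp_comm.mp hfq.bohrCoeff_eq_zero hne)
    exact hx ⟨⟨n, hn⟩, by simp only [← hxn, Real.toNNReal_coe]⟩
  refine (hasSum_subtype_iff_of_support_subset fun n hn => ?_).mp hsum
  rintro rfl
  exact hn (LSeries.term_zero ..)

/-- The first nonzero coefficient of the Dirichlet series `∑ a n * n ^ (-s)` is the one of
`m ^ (-s)`. -/
structure IsLeadingIndex (a : ℕ → ℂ) (m : ℕ) : Prop where
  index_ne_zero : m ≠ 0
  eq_zero : ∀ k < m, a k = 0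
  ne_zero : a m ≠ 0

theorem exists_isLeadingIndex {a : ℕ → ℂ} (h0 : a 0 = 0) (ha : a ≠ 0) :
    ∃ m, IsLeadingIndex a m := by
  classical
  have hex : ∃ k, a k ≠ 0 := Function.ne_iff.mp ha
  exact ⟨Nat.find hex, fun hm => Nat.find_spec hex (hm ▸ h0),
    fun k hk => not_not.mp (Nat.find_min hex hk), Nat.find_spec hex⟩

theorem IsLeadingIndex.eventually_exists_cexp_eq {a : ℕ → ℂ} {m : ℕ} {f : ℂ → ℂ} {σ : ℝ}
    (ha : IsLeadingIndex a m) (h : HasLSeriesOn a f σ) :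
    ∀ᶠ τ in atTop, ∃ g N, HasExpansion (freq m) τ g N ∧
      ∀ s : ℂ, τ ≤ s.re → Complex.exp (g s) = (m : ℂ) ^ s * f s := by
  obtain ⟨M, hM⟩ := h.exists_hasExpansion_sub ha.index_ne_zero ha.eq_zero
  filter_upwards [hM.eventually_exists_lt (by simp) (norm_pos_iff.mpr ha.ne_zero)]
    with τ ⟨N, hN, hE⟩
  have hE' := (hE.mono_freq Set.sdiff_subset).const_mul (a m)⁻¹
  have hN' : ‖(a m)⁻¹‖ * N < 1 := by
    rwa [norm_inv, inv_mul_lt_one₀ (norm_pos_iff.mpr ha.ne_zero)]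
  obtain ⟨K, hK⟩ := hE'.clog hN'
  refine ⟨_, _, (HasExpansion.const (freq m).zero_mem (Complex.log (a m))).add hK, fun s hs => ?_⟩
  have hne : 1 + (a m)⁻¹ * ((m : ℂ) ^ s * f s - a m) ≠ 0 := fun h0 => by
    have hlt := (hE'.norm_le hs).trans_lt hN'
    rw [eq_neg_of_add_eq_zero_right h0, norm_neg, norm_one] at hlt
    exact hlt.false
  rw [Complex.exp_add, Complex.exp_log ha.ne_zero, Complex.exp_log hne, mul_add, mul_one,
    mul_inv_cancel_left₀ ha.ne_zero, add_sub_cancel]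

theorem IsLeadingIndex.tendsto_cpow_mul {a : ℕ → ℂ} {m : ℕ} {f : ℂ → ℂ} {σ : ℝ}
    (ha : IsLeadingIndex a m) (h : HasLSeriesOn a f σ) :
    Tendsto (fun x : ℝ => (m : ℂ) ^ (x : ℂ) * f x) atTop (𝓝 (a m)) := by
  obtain ⟨k, rfl⟩ := Nat.exists_eq_succ_of_ne_zero ha.index_ne_zero
  have hlim := LSeries.tendsto_cpow_mul_atTop (fun i hi => ha.eq_zero i (Nat.lt_succ_of_le hi))
    (h.abscissaOfAbsConv_le.trans_lt (EReal.coe_lt_top σ))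
  rw [← Nat.cast_succ] at hlim
  refine hlim.congr' ?_
  filter_upwards [eventually_ge_atTop σ] with x hx
  rw [(h (s := x) hx).LSeries_eq]

theorem IsLeadingIndex.tendsto_re_div_mul_log {φ : ℂ → ℂ} {n m : ℕ} {a : ℕ → ℂ} {σ : ℝ}
    (ha : IsLeadingIndex a m) (hn : n ≠ 0) (h : HasLSeriesOn a (fun s => (n : ℂ) ^ (-φ s)) σ) :
    Tendsto (fun x : ℝ => (φ x).re / x * Real.log n) atTop (𝓝 (Real.log m)) := by
  have hlog : Tendsto (fun x : ℝ => x * Real.log m - (φ x).re * Real.log n) atTop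
      (𝓝 (Real.log ‖a m‖)) := by
    refine ((ha.tendsto_cpow_mul h).norm.log (norm_ne_zero_iff.mpr ha.ne_zero)).congr fun x => ?_
    rw [natCast_cpow_eq_exp ha.index_ne_zero, natCast_cpow_eq_exp hn, ← Complex.exp_add,
      Complex.norm_exp, Real.log_exp, Complex.add_re, Complex.re_ofReal_mul,
      Complex.re_ofReal_mul, Complex.ofReal_re, Complex.neg_re]
    ring
  rw [← sub_zero (Real.log m)]
  refine ((hlog.div_atTop tendsto_id).const_sub (Real.log m)).congr' ?_
  filter_upwards [eventually_ne_atTop 0] with x hx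
  simp only [id]
  field_simp
  ring

theorem IsLeadingIndex.eventually_exists_hasExpansion {φ : ℂ → ℂ} {n c : ℕ} {a : ℕ → ℂ} {σ : ℝ}
    (ha : IsLeadingIndex a (n ^ c)) (hn : 1 < n)
    (h : HasLSeriesOn a (fun s => (n : ℂ) ^ (-φ s)) σ) :
    ∀ᶠ τ in atTop, ∃ g N, HasExpansion (freq (n ^ c)) τ g N ∧ ∀ s : ℂ, τ ≤ s.re →
      ∃ k : ℤ, φ s - c * s = g s + k • (2 * Real.pi * Complex.I / Real.log n) := by
  have hn0 : n ≠ 0 := Nat.ne_zero_of_lt hn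
  have hlog : (Real.log n : ℂ) ≠ 0 := by
    exact_mod_cast (Real.log_pos (Nat.one_lt_cast.mpr hn)).ne'
  filter_upwards [ha.eventually_exists_cexp_eq h] with τ ⟨g, N, hg, hexp⟩
  refine ⟨_, _, hg.const_mul (-(Real.log n : ℂ)⁻¹), fun s hs => ?_⟩
  have hexp' : Complex.exp (g s) = Complex.exp (-(Real.log n * (φ s - c * s))) := by
    rw [hexp s hs, natCast_cpow_eq_exp (pow_ne_zero c hn0), natCast_cpow_eq_exp hn0,
      ← Complex.exp_add, Nat.cast_pow, Real.log_pow]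
    push_cast
    ring_nf
  obtain ⟨k, hk⟩ := Complex.exp_eq_exp_iff_exists_int.mp hexp'
  refine ⟨k, ?_⟩
  rw [hk, zsmul_eq_mul]
  field_simp
  ring

theorem single_mem_HPlus {n : ℕ} (hn : n ≠ 0) : (Pi.single n 1 : ℕ → ℂ) ∈ HPlus := by
  refine ⟨Pi.single_eq_of_ne hn.symm _, fun k _ => ⟨?_, ?_⟩⟩
  · simp [translate, Pi.single_eq_of_ne hn.symm]
  · refine memℓp_gen (summable_of_ne_finset_zero (s := {n}) fun i hi => ?_)
    simp [translate, Pi.single_eq_of_ne (Finset.notMem_singleton.mp hi)]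

theorem eq_of_hasSumAt_single {n : ℕ} (hn : n ≠ 0) {s v : ℂ}
    (h : HasSumAt (Pi.single n 1 : ℕ → ℂ) s v) : v = (n : ℂ) ^ (-s) := by
  refine tendsto_nhds_unique h (tendsto_const_nhds.congr' ?_)
  filter_upwards [eventually_ge_atTop n] with N hN
  rw [Finset.sum_eq_single_of_mem n (Finset.mem_Icc.mpr ⟨Nat.pos_of_ne_zero hn, hN⟩)
    fun k _ hk => by rw [Pi.single_eq_of_ne hk, zero_mul], Pi.single_eq_same, one_mul]

namespace DefinesCompositionOperator

variable {θ : ℝ} {φ : ℂ → ℂ}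

theorem exists_isLeadingIndex (h : DefinesCompositionOperator θ φ) {n : ℕ} (hn : n ≠ 0) :
    ∃ a m σ, IsLeadingIndex a m ∧ HasLSeriesOn a (fun s => (n : ℂ) ^ (-φ s)) σ := by
  obtain ⟨C, hC⟩ := h
  obtain ⟨σ, -, hσ⟩ := hC ⟨_, single_mem_HPlus hn⟩
  generalize C ⟨_, single_mem_HPlus hn⟩ = a at hσ
  have hseries : HasLSeriesOn a (fun s => (n : ℂ) ^ (-φ s)) (σ + 2) :=
    .of_hasSumAt (fun s hs => by
      obtain ⟨v, hv, hv'⟩ := hσ s hs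
      rwa [← eq_of_hasSumAt_single hn hv]) (by linarith)
  have ha0 : (a : ℕ → ℂ) ≠ 0 := fun h0 => by
    have hzero : (0 : ℂ) = (n : ℂ) ^ (-φ (σ + 2 : ℝ)) := by
      simpa only [h0, LSeries_zero, Pi.zero_apply] using
        (hseries (s := (σ + 2 : ℝ)) le_rfl).LSeries_eq
    exact Complex.exp_ne_zero _ (hzero.trans (natCast_cpow_eq_exp hn _)).symm
  obtain ⟨m, hm⟩ := DirichletSeries.exists_isLeadingIndex a.2.1 ha0
  exact ⟨a, m, σ + 2, hm, hseries⟩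

theorem exists_isLeadingIndex_pow (h : DefinesCompositionOperator θ φ) :
    ∃ c : ℕ, ∀ n : ℕ, n ≠ 0 → ∃ a σ, IsLeadingIndex a (n ^ c) ∧
      HasLSeriesOn a (fun s => (n : ℂ) ^ (-φ s)) σ := by
  obtain ⟨κ, hκ⟩ : ∃ κ, Tendsto (fun x : ℝ => (φ x).re / x) atTop (𝓝 κ) := by
    obtain ⟨a, m, σ, ha, hseries⟩ := h.exists_isLeadingIndex two_ne_zero
    have hlog : Real.log (2 : ℕ) ≠ 0 := (Real.log_pos (by norm_num)).ne'
    refine ⟨Real.log m / Real.log (2 : ℕ), ?_⟩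
    simpa only [mul_div_cancel_right₀ _ hlog] using
      (ha.tendsto_re_div_mul_log two_ne_zero hseries).div_const (Real.log (2 : ℕ))
  have hrpow : ∀ (n m : ℕ) (a : ℕ → ℂ) (σ : ℝ), n ≠ 0 → IsLeadingIndex a m →
      HasLSeriesOn a (fun s => (n : ℂ) ^ (-φ s)) σ → (n : ℝ) ^ κ = m :=
    fun n m a σ hn ha hseries => by
      have hlog : κ * Real.log n = Real.log m :=
        tendsto_nhds_unique (hκ.mul_const _) (ha.tendsto_re_div_mul_log hn hseries)
      rw [Real.rpow_def_of_pos (Nat.cast_pos.mpr (Nat.pos_of_ne_zero hn)), mul_comm, hlog,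
        Real.exp_log (Nat.cast_pos.mpr (Nat.pos_of_ne_zero ha.index_ne_zero))]
  obtain ⟨c, rfl⟩ := exists_natCast_eq_of_forall_rpow fun n hn =>
    let ⟨a, m, σ, ha, hseries⟩ := h.exists_isLeadingIndex hn.ne'
    ⟨m, by rw [hrpow n m a σ hn.ne' ha hseries, Int.cast_natCast]⟩
  refine ⟨c, fun n hn => ?_⟩
  obtain ⟨a, m, σ, ha, hseries⟩ := h.exists_isLeadingIndex hn
  obtain rfl : n ^ c = m := by
    exact_mod_cast Real.rpow_natCast (n : ℝ) c ▸ hrpow n m a σ hn ha hseries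
  exact ⟨a, σ, ha, hseries⟩

theorem exists_hasLSeriesOn_sub (h : DefinesCompositionOperator θ φ) :
    ∃ (c : ℕ) (e : ℕ → ℂ) (τ : ℝ), e 0 = 0 ∧ HasLSeriesOn e (fun s => φ s - c * s) τ := by
  obtain ⟨c, hc⟩ := h.exists_isLeadingIndex_pow
  obtain ⟨a₂, σ₂, ha₂, h₂⟩ := hc 2 two_ne_zero
  obtain ⟨a₃, σ₃, ha₃, h₃⟩ := hc 3 three_ne_zero
  obtain ⟨τ, ⟨g₂, N₂, hg₂, hφ₂⟩, g₃, N₃, hg₃, hφ₃⟩ :=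
    ((ha₂.eventually_exists_hasExpansion one_lt_two h₂).and
      (ha₃.eventually_exists_hasExpansion (by norm_num) h₃)).exists
  obtain ⟨k, l, hkl⟩ := exists_eqOn_add_zsmul_of_isPreconnected
    (convex_halfSpace_re_ge τ).isPreconnected hg₂.continuousOn hg₃.continuousOn
    (fun _ _ => eq_zero_of_zsmul_period_eq_zsmul_period one_lt_two (by norm_num) (by norm_num))
    hφ₂ hφ₃
  obtain ⟨e, he0, he⟩ := HasExpansion.exists_hasLSeriesOn (pow_ne_zero c two_ne_zero)
    (pow_ne_zero c three_ne_zero) (Nat.Coprime.pow c c (by norm_num))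
    ((hg₂.add (.const (freq _).zero_mem _)).congr fun s hs => (hkl s hs).1.symm)
    ((hg₃.add (.const (freq _).zero_mem _)).congr fun s hs => (hkl s hs).2.symm)
  exact ⟨c, e, τ, he0, he⟩

end DefinesCompositionOperator

theorem exists_mul_cexp_eq_neg_norm (z : ℂ) {l : ℝ} (hl : l ≠ 0) :
    ∃ t : ℝ, Complex.exp (-(l * (t * Complex.I))) * z = -‖z‖ := by
  refine ⟨(z.arg - Real.pi) / l, ?_⟩
  have hangle : -(l * (((z.arg - Real.pi) / l : ℝ) * Complex.I)) =
      Real.pi * Complex.I - z.arg * Complex.I := by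
    rw [← mul_assoc, ← Complex.ofReal_mul, mul_div_cancel₀ _ hl]
    push_cast
    ring
  nth_rw 2 [← Complex.norm_mul_exp_arg_mul_I z]
  rw [hangle, mul_left_comm, ← Complex.exp_add, sub_add_cancel, Complex.exp_pi_mul_I, mul_neg_one]

theorem IsLeadingIndex.exists_re_neg {a : ℕ → ℂ} {m : ℕ} {f : ℂ → ℂ} {σ : ℝ}
    (ha : IsLeadingIndex a m) (hm : 1 < m) (h : HasLSeriesOn a f σ) :
    ∃ s : ℂ, σ ≤ s.re ∧ (f s).re < 0 := by
  obtain ⟨M, hM⟩ := h.exists_hasExpansion_sub ha.index_ne_zero ha.eq_zero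
  obtain ⟨τ, ⟨N, hN, hE⟩, hτ⟩ := ((hM.eventually_exists_lt (by simp)
    (norm_pos_iff.mpr ha.ne_zero)).and (eventually_ge_atTop σ)).exists
  obtain ⟨t, ht⟩ := exists_mul_cexp_eq_neg_norm (a m)
    (Real.log_pos (Nat.one_lt_cast.mpr hm)).ne'
  set s : ℂ := τ + t * Complex.I
  have hs : s.re = τ := by simp [s]
  set u : ℂ := Complex.exp (-(Real.log m * (t * Complex.I)))
  have hu : ‖u‖ = 1 := by
    simp only [u, Complex.norm_exp, Complex.neg_re, Complex.re_ofReal_mul, Complex.I_re, mul_zero,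
      neg_zero, Real.exp_zero]
  have hf : f s = Real.exp (-(Real.log m * τ)) * (-‖a m‖ + u * ((m : ℂ) ^ s * f s - a m)) := by
    have hexp : (Real.exp (-(Real.log m * τ)) : ℂ) * u * (m : ℂ) ^ s = 1 := by
      rw [natCast_cpow_eq_exp ha.index_ne_zero, Complex.ofReal_exp, ← Complex.exp_add,
        ← Complex.exp_add, Complex.exp_eq_one_iff]
      exact ⟨0, by simp only [s]; push_cast; ring⟩
    linear_combination Real.exp (-(Real.log m * τ)) * ht - f s * hexp
  have herr : (u * ((m : ℂ) ^ s * f s - a m)).re ≤ N := by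
    refine (Complex.re_le_norm _).trans ?_
    rw [norm_mul, hu, one_mul]
    exact hE.norm_le hs.ge
  refine ⟨s, hτ.trans hs.ge, ?_⟩
  rw [hf, Complex.re_ofReal_mul, Complex.add_re, Complex.neg_re, Complex.ofReal_re]
  exact mul_neg_of_pos_of_neg (Real.exp_pos _) (by linarith)

theorem HasLSeriesOn.lt_re_coeff_one {a : ℕ → ℂ} {f : ℂ → ℂ} {σ r : ℝ} (h : HasLSeriesOn a f σ)
    (ha : a 0 = 0) (hr : ∀ s : ℂ, σ ≤ s.re → r < (f s).re) : r < (a 1).re := by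
  have hsub : HasLSeriesOn (Function.update a 1 0) (fun s => f s - a 1) σ := by
    simpa [LSeries.term] using h.update_zero 1
  obtain hzero | hne := eq_or_ne (Function.update a 1 0) 0
  · have hf : f σ = a 1 := sub_eq_zero.mp ((hsub (s := σ) le_rfl).LSeries_eq.symm.trans (by
      rw [hzero, LSeries_zero, Pi.zero_apply]))
    exact hf ▸ hr σ le_rfl
  obtain ⟨m, hm⟩ := exists_isLeadingIndex (by simpa using ha) hne
  have hm1 : 1 < m := (Nat.one_le_iff_ne_zero.mpr hm.index_ne_zero).lt_of_ne fun h1 =>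
    hm.ne_zero (h1 ▸ Function.update_self ..)
  obtain ⟨s, hs, hneg⟩ := hm.exists_re_neg hm1 hsub
  exact (hr s hs).trans (sub_neg.mp (Complex.sub_re .. ▸ hneg))

theorem lSeriesSummable_of_mem_HPlus {a : ℕ → ℂ} (ha : a ∈ HPlus) {s : ℂ} (hs : 1 / 2 < s.re) :
    LSeriesSummable a s := by
  obtain ⟨k, hk⟩ := exists_nat_one_div_lt (sub_pos.mpr hs)
  set y : ℝ := 1 / ((k + 1 : ℕ) : ℝ)
  have hy : y < s.re - 1 / 2 := by simpa [y] using hk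
  have hsq : Summable fun n => ‖translate y a n‖ ^ (2 : ℝ) := by
    simpa only [ENNReal.toReal_ofNat] using (ha.2 (k + 1) k.succ_pos).2.summable (by norm_num)
  have hpow : Summable fun n : ℕ => ((n : ℝ) ^ (y - s.re)) ^ (2 : ℝ) := by
    simp only [← Real.rpow_mul (Nat.cast_nonneg _)]
    exact Real.summable_nat_rpow.mpr (by linarith)
  refine Summable.of_norm (((Real.summable_mul_of_Lp_Lq_of_nonneg .two_two
    (fun n => norm_nonneg _) (fun n => by positivity) hsq hpow)).congr fun n => ?_)
  obtain rfl | hn := eq_or_ne n 0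
  · simp [translate, ha.1]
  have hn0 : (0 : ℝ) < n := Nat.cast_pos.mpr (Nat.pos_of_ne_zero hn)
  simp only [LSeries.norm_term_eq, if_neg hn, translate, LinearMap.coe_mk, AddHom.coe_mk, norm_mul,
    Complex.norm_natCast_cpow_of_pos (Nat.pos_of_ne_zero hn), Complex.neg_re, Complex.ofReal_re]
  rw [mul_assoc, ← Real.rpow_add hn0, neg_add_eq_sub, sub_sub_cancel_left, Real.rpow_neg hn0.le,
    div_eq_mul_inv]

section Composition

variable {E : ℂ → ℂ} {τ N : ℝ}

theorem HasExpansion.natCast_cpow (hE : HasExpansion (freq 1) τ E N) (c : ℕ) (b : ℂ) {n : ℕ}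
    (hn : n ≠ 0) : HasExpansion (freq 1) τ (fun s => (n : ℂ) ^ (-(c * s + b + E s)))
      ((n : ℝ) ^ (-(c * τ + b.re - N))) := by
  have hlog : 0 ≤ Real.log n := Real.log_natCast_nonneg n
  have hn0 : (0 : ℝ) < n := Nat.cast_pos.mpr (Nat.pos_of_ne_zero hn)
  have hcoe : ((Real.log n * c).toNNReal : ℝ) = Real.log n * c :=
    Real.coe_toNNReal _ (by positivity)
  have hmem : (Real.log n * c).toNNReal ∈ freq 1 :=
    ⟨n ^ c, 0, pow_ne_zero c hn, by
      rw [hcoe, Nat.cast_pow, Real.log_pow, Nat.cast_zero, zero_mul, sub_zero, mul_comm]⟩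
  have hprod := (HasExpansion.term (σ := τ) hmem ((n : ℂ) ^ (-b))).mul
    (hE.const_mul (-(Real.log n : ℂ))).cexp
  have hnorm : ‖(n : ℂ) ^ (-b)‖ * Real.exp (-((Real.log n * c).toNNReal * τ)) *
      Real.exp (‖-(Real.log n : ℂ)‖ * N) = (n : ℝ) ^ (-(c * τ + b.re - N)) := by
    rw [Complex.norm_natCast_cpow_of_pos (Nat.pos_of_ne_zero hn), norm_neg, Complex.norm_real,
      Real.norm_of_nonneg hlog, Real.rpow_def_of_pos hn0, Real.rpow_def_of_pos hn0,
      ← Real.exp_add, ← Real.exp_add, hcoe, Complex.neg_re]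
    ring_nf
  rw [hnorm] at hprod
  refine hprod.congr fun s _ => ?_
  rw [natCast_cpow_eq_exp hn, natCast_cpow_eq_exp hn, ← Complex.exp_add, ← Complex.exp_add, hcoe]
  push_cast
  ring_nf

theorem HasExpansion.lSeries_comp (hE : HasExpansion (freq 1) τ E N) (c : ℕ) (b : ℂ) {a : ℕ → ℂ}
    (ha : LSeriesSummable a (c * τ + b.re - N : ℝ)) :
    ∃ M, HasExpansion (freq 1) τ (fun s => LSeries a (c * s + b + E s)) M := by
  refine ⟨_, HasExpansion.hasSum (F := fun n s => LSeries.term a (c * s + b + E s) n) (fun n => ?_)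
    ha.norm.hasSum fun s hs => (ha.of_re_le_re ?_).hasSum⟩
  · obtain rfl | hn := eq_or_ne n 0
    · simpa using HasExpansion.const (σ := τ) (freq 1).zero_mem 0
    · rw [LSeries.norm_term_eq, if_neg hn, Complex.ofReal_re, div_eq_mul_inv,
        ← Real.rpow_neg (Nat.cast_nonneg n)]
      simpa only [LSeries.term_of_ne_zero hn, div_eq_mul_inv, Complex.cpow_neg] using
        (hE.natCast_cpow c b hn).const_mul (a n)
  · have hre : -N ≤ (E s).re :=
      (neg_le_neg (hE.norm_le hs)).trans (neg_le_of_abs_le (Complex.abs_re_le_norm _))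
    have hcs : c * τ ≤ c * s.re := by gcongr
    simp only [Complex.ofReal_re, Complex.add_re, ← Complex.ofReal_natCast, Complex.re_ofReal_mul]
    linarith

end Composition

section Backward

variable {θ : ℝ} {φ : ℂ → ℂ}

theorem definesCompositionOperator_of_forall_exists {τ : ℝ} (hθ : θ ≤ τ)
    (hre : ∀ s : ℂ, τ ≤ s.re → 1 / 2 < (φ s).re)
    (h : ∀ a ∈ HPlus, ∃ e : ℕ → ℂ, e 0 = 0 ∧ HasLSeriesOn e (fun s => LSeries a (φ s)) τ) :
    DefinesCompositionOperator θ φ := by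
  choose e he0 he using fun a : HPlus => h a a.2
  have hsummable : ∀ (a : HPlus) (s : ℂ), τ ≤ s.re → LSeriesSummable (a : ℕ → ℂ) (φ s) :=
    fun a s hs => lSeriesSummable_of_mem_HPlus a.2 (hre s hs)
  have hadd : ∀ a b, e (a + b) = e a + e b := fun a b => by
    refine (he (a + b)).unique (((he a).add (he b)).congr fun s hs => ?_) (by simp [he0])
    exact (LSeries_add (hsummable a s hs) (hsummable b s hs)).symm
  have hsmul : ∀ (c : ℂ) a, e (c • a) = c • e a := fun c a => by
    refine (he (c • a)).unique (((he a).smul c).congr fun s _ => ?_) (by simp [he0])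
    exact (LSeries_smul ..).symm
  refine ⟨{ toFun := fun a => ⟨e a, (he a).mem_D (he0 a)⟩
            map_add' := fun a b => Subtype.ext (hadd a b)
            map_smul' := fun c a => Subtype.ext (hsmul c a) }, fun a => ⟨τ, hθ, fun s hs => ?_⟩⟩
  have hs' : τ ≤ s.re := le_of_lt hs
  exact ⟨_, hasSumAt_of_summable (hsummable a s hs'), (he a).hasSumAt hs'⟩

theorem HasLSeriesOn.eventually_lt_mul_add_re_coeff_one {e : ℕ → ℂ} {c : ℕ} {σ r : ℝ}
    (h : HasLSeriesOn e (fun s => φ s - c * s) σ) (he : e 0 = 0)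
    (hr : ∀ s : ℂ, σ ≤ s.re → r < (φ s).re) :
    ∀ᶠ τ : ℝ in atTop, r < c * τ + (e 1).re := by
  obtain rfl | hc := eq_or_ne c 0
  · have hlt : r < (e 1).re := h.lt_re_coeff_one he (by simpa using hr)
    exact Eventually.of_forall fun _ => by simpa using hlt
  · have hc0 : (0 : ℝ) < c := Nat.cast_pos.mpr (Nat.pos_of_ne_zero hc)
    exact (tendsto_atTop_add_const_right _ _
      (tendsto_id.const_mul_atTop hc0)).eventually_gt_atTop r

theorem HasLSeriesOn.definesCompositionOperator {e : ℕ → ℂ} {c : ℕ} {σ : ℝ}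
    (h : HasLSeriesOn e (fun s => φ s - c * s) σ) (he : e 0 = 0)
    (hφ : Set.MapsTo φ (halfPlane θ) (halfPlane (1 / 2))) : DefinesCompositionOperator θ φ := by
  have hre : ∀ s : ℂ, max σ (θ + 1) ≤ s.re → 1 / 2 < (φ s).re := fun s hs =>
    hφ ((lt_add_one θ).trans_le ((le_max_right _ _).trans hs))
  obtain ⟨τ₀, hτ₀⟩ :=
    ((h.mono (le_max_left σ (θ + 1))).eventually_lt_mul_add_re_coeff_one he hre).exists
  obtain ⟨M, hM⟩ := h.exists_hasExpansion_sub one_ne_zero (by simpa using he)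
  obtain ⟨τ, ⟨N, hN, hE⟩, hτ, hτ'⟩ := ((hM.eventually_exists_lt (by simp) (sub_pos.mpr hτ₀)).and
    ((eventually_ge_atTop τ₀).and (eventually_ge_atTop (max σ (θ + 1))))).exists
  have hX : 1 / 2 < c * τ + (e 1).re - N := by
    have hcτ : c * τ₀ ≤ c * τ := by gcongr
    linarith
  refine definesCompositionOperator_of_forall_exists
    ((le_add_of_nonneg_right zero_le_one).trans ((le_max_right _ _).trans hτ'))
    (fun s hs => hre s (hτ'.trans hs)) fun a ha => ?_
  obtain ⟨K, hK⟩ := (hE.mono_freq Set.sdiff_subset).lSeries_comp c (e 1)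
    (lSeriesSummable_of_mem_HPlus ha hX)
  have hK' : HasExpansion (freq 1) τ (fun s => LSeries a (φ s)) K := hK.congr fun s _ => by
    simp
  exact hK'.exists_hasLSeriesOn one_ne_zero one_ne_zero (Nat.coprime_one_left 1) hK'

end Backward

end DirichletSeries

theorem theorem4p1 (θ : ℝ) (φ : ℂ → ℂ)
    (hφ : Set.MapsTo φ (DirichletSeries.halfPlane θ) (DirichletSeries.halfPlane (1 / 2))) :
    DirichletSeries.DefinesCompositionOperator θ φ ↔
      ∃ μ : ℝ, θ ≤ μ ∧ AnalyticOnNhd ℂ φ (DirichletSeries.halfPlane μ) ∧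
        ∃ c₀ : ℕ, ∃ ϕ ∈ DirichletSeries.D, ∀ s ∈ DirichletSeries.halfPlane μ,
          ∃ v : ℂ, DirichletSeries.HasSumAt ϕ s v ∧ φ s = c₀ * s + v := by
  constructor
  · intro h
    obtain ⟨c, e, τ, he0, he⟩ := h.exists_hasLSeriesOn_sub
    have he' := he.mono (le_max_right θ τ)
    have hanalytic : AnalyticOnNhd ℂ (fun s => c * s + (φ s - c * s))
        (DirichletSeries.halfPlane (max θ τ)) :=
      (analyticOnNhd_const.mul analyticOnNhd_id).add he'.analyticOnNhd
    refine ⟨max θ τ, le_max_left θ τ, by simpa using hanalytic, c, e, he.mem_D he0, fun s hs => ?_⟩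
    exact ⟨_, he'.hasSumAt (le_of_lt hs), (add_sub_cancel _ _).symm⟩
  · rintro ⟨μ, -, -, c, e, he, h⟩
    have hsum : ∀ s ∈ DirichletSeries.halfPlane μ,
        DirichletSeries.HasSumAt e s (φ s - c * s) := fun s hs => by
      obtain ⟨v, hv, hs⟩ := h s hs
      rwa [hs, add_sub_cancel_left]
    exact (DirichletSeries.HasLSeriesOn.of_hasSumAt hsum (lt_add_one _)).definesCompositionOperator
      he.1 hφ
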